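/- For $n\ge 1$ let $h_n=\sum_{k=1}^n \frac1{2k-1}$, and for $\Re s>1$ let $\zeta_h(s)=\sum_{n=1}^\infty h_n n^{-s}$. For every $s\in\mathbb C$ with $\Re s>1$, the series $\zeta_h(s)$ and the integral $\int_0^\infty \log^2(\tanh x)\,x^{s-2}\,dx$ converge absolutely, and $$\zeta_h(s)=\frac{4^{s-2}}{\Gamma(s-1)}\int_0^\infty \log^2(\tanh x)\,x^{s-2}\,dx .$$ The function $\zeta_h$ extends to a meromorphic function on $\mathbb C$ which is analytic except at the points $s=1$ and $s=1-2n$ $(n=1,2,\dots)$. At $s=1$ it has a pole of order exactly $2$ with residue $\log 2+\gamma/2$, where $\gamma$ is the Euler--Mascheroni constant. For every integer $n\ge1$, it has a simple pole at $s=1-2n$ with residue $-B_{2n}(1/2)/(4n)$, where $B_m(x)$ denotes the $m$-th Bernoulli polynomial. The extended function vanishes at $s=-2n$ for every integer $n\ge 0$; in particular it vanishes at all negative even integers. -/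

import Mathlib

/-- The odd harmonic numbers `h n = 1 + 1/3 + ⋯ + 1/(2n - 1)`. -/
noncomputable def oddHarmonic (n : ℕ) : ℝ :=
  ∑ k ∈ Finset.Icc 1 n, 1 / (2 * (k : ℝ) - 1)

/-- The coefficients of the Dirichlet series `∑_{n ≥ 1} h n / n ^ s`, as complex numbers. -/
noncomputable def hZetaCoeff (n : ℕ) : ℂ := (oddHarmonic n : ℂ)

/-- The `h`-zeta function as a Dirichlet series, `∑_{n ≥ 1} h n / n ^ s`
(a convergent series for `Re s > 1`). -/
noncomputable def hZeta (s : ℂ) : ℂ := LSeries hZetaCoeff s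

/-- `c` is the residue at `z₀` of a function `f` that is meromorphic at `z₀`: near `z₀`, away from
`z₀` itself, `f` is the sum of an analytic function `g` and of a finite principal part whose
coefficient at `1 / (z - z₀)` is `c`. -/
def HasResidueAt (f : ℂ → ℂ) (z₀ c : ℂ) : Prop :=
  ∃ (N : ℕ) (a : ℕ → ℂ) (g : ℂ → ℂ), AnalyticAt ℂ g z₀ ∧
    ∀ᶠ z in nhdsWithin z₀ {z₀}ᶜ,
      f z = c / (z - z₀) + ∑ k ∈ Finset.range N, a k / (z - z₀) ^ (k + 2) + g z

open Filter Topology Asymptotics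

/-! With t = e^{-2x}, -log tanh x = log((1+t)/(1-t)) = 2 Σ t^{2k+1}/(2k+1). Squaring gives log² tanh
x = Σ 4 (h_n/n) e^{-4nx} (`hasSum_sq_log_tanh`), and a termwise Mellin transform at w = s - 1 gives
the integral formula (`hZeta_eq_mellin`).

Singularities come from x → 0⁺. There log tanh x = log x + L(x) with L = `logTanhDiv` even, analytic
and L(0) = 0, so log² tanh x = log² x + 2 L(x) log x + L(x)². A term (a + b log x + c log² x) x^k
contributes a/(w+k) - b/(w+k)² + 2c/(w+k)³ to the continued transform
(`HasLogExpansion.exists_continuation`): a triple pole at w = 0, poles of order at most two at w =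
-2n, nothing at odd k by evenness. The factor 1/Γ(w) has simple zeros at w = 0, -1, -2, …: it lowers
each pole order by one and makes the product vanish at w = -2n - 1, that is s = -2n.

The residues need the Taylor coefficients of L. Since 1 + x L'(x) = 4x e^{2x}/(e^{4x} - 1) is the
Bernoulli generating function at 1/2 in the variable 4x, they are multiples of B_n(1/2)
(`coeff_taylorSeries_logTanhDiv`). That the poles are genuine is `bernoulli_eval_half_ne_zero`. -/

/-! ### The Dirichlet series as a Mellin transform. -/

lemma oddHarmonic_eq_sum_range (n : ℕ) :
    oddHarmonic n = ∑ k ∈ Finset.range n, 1 / (2 * (k : ℝ) + 1) := by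
  rw [oddHarmonic]
  induction n with
  | zero => simp
  | succ n ih =>
    rw [Finset.sum_Icc_succ_top (by omega), Finset.sum_range_succ, ih]
    push_cast
    ring_nf

/-- Partial fractions: (2i+1) + (2j+1) = 2(n+1) when i + j = n. These are the Cauchy product
coefficients of the squared odd series. -/
lemma sum_antidiagonal_inv_odd_mul_inv_odd (n : ℕ) :
    ∑ p ∈ Finset.HasAntidiagonal.antidiagonal n, (1 / (2 * (p.1 : ℝ) + 1)) * (1 / (2 * (p.2 : ℝ) + 1)) =
      oddHarmonic (n + 1) / (n + 1) := by
  have h1 : ∑ p ∈ Finset.HasAntidiagonal.antidiagonal n, (1 / (2 * (p.1 : ℝ) + 1)) = oddHarmonic (n + 1) := by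
    rw [oddHarmonic_eq_sum_range, Finset.Nat.sum_antidiagonal_eq_sum_range_succ_mk]
  have h2 : ∑ p ∈ Finset.HasAntidiagonal.antidiagonal n, (1 / (2 * (p.2 : ℝ) + 1)) = oddHarmonic (n + 1) := by
    rw [← h1, ← Finset.Nat.sum_antidiagonal_swap]
    simp
  have h3 : ∀ p ∈ Finset.HasAntidiagonal.antidiagonal n,
      (1 / (2 * (p.1 : ℝ) + 1)) * (1 / (2 * (p.2 : ℝ) + 1)) =
        (1 / (2 * (n + 1 : ℝ))) * (1 / (2 * (p.1 : ℝ) + 1) + 1 / (2 * (p.2 : ℝ) + 1)) := by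
    intro p hp
    have : (n : ℝ) = p.1 + p.2 := by rw [← Finset.HasAntidiagonal.mem_antidiagonal.1 hp]; push_cast; rfl
    rw [this]
    have : (0 : ℝ) < 2 * p.1 + 1 := by positivity
    have : (0 : ℝ) < 2 * p.2 + 1 := by positivity
    field_simp
    ring
  rw [Finset.sum_congr rfl h3, ← Finset.mul_sum, Finset.sum_add_distrib, h1, h2]
  have : (0 : ℝ) < n + 1 := by positivity
  field_simp
  ring

lemma hasSum_sq_log_sub_log {t : ℝ} (h0 : 0 ≤ t) (h1 : t < 1) :
    HasSum (fun n : ℕ => 4 * oddHarmonic n / n * t ^ (2 * n))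
      ((Real.log (1 + t) - Real.log (1 - t)) ^ 2) := by
  have hs := Real.hasSum_log_sub_log_of_abs_lt_one (x := t) (by rwa [abs_of_nonneg h0])
  have hn : Summable fun k : ℕ => ‖(2 : ℝ) * (1 / (2 * k + 1)) * t ^ (2 * k + 1)‖ :=
    hs.summable.norm
  have hprod := tsum_mul_tsum_eq_tsum_sum_antidiagonal_of_summable_norm hn hn
  have hsum := (summable_norm_sum_mul_antidiagonal_of_summable_norm hn hn).of_norm.hasSum
  rw [← hprod, hs.tsum_eq, ← sq] at hsum
  -- The term n = 0 is zero because division by zero is zero, so the series may start at n = 1.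
  rw [← hasSum_nat_add_iff' 1]
  simp only [Finset.range_one, Finset.sum_singleton, Nat.cast_zero, div_zero, zero_mul, sub_zero]
  refine hsum.congr_fun fun n => ?_
  rw [show 4 * oddHarmonic (n + 1) / ((n + 1 : ℕ) : ℝ) * t ^ (2 * (n + 1)) =
    4 * t ^ (2 * (n + 1)) * (oddHarmonic (n + 1) / (n + 1)) by push_cast; ring,
    ← sum_antidiagonal_inv_odd_mul_inv_odd, Finset.mul_sum]
  refine Finset.sum_congr rfl fun p hp => ?_
  rw [← Finset.HasAntidiagonal.mem_antidiagonal.1 hp]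
  ring

lemma tanh_eq_one_sub_div_one_add (x : ℝ) :
    Real.tanh x = (1 - Real.exp (-2 * x)) / (1 + Real.exp (-2 * x)) := by
  have h : Real.exp (-2 * x) = (Real.exp x)⁻¹ * (Real.exp x)⁻¹ := by
    rw [← Real.exp_neg, ← Real.exp_add]; ring_nf
  rw [Real.tanh_eq_sinh_div_cosh, Real.sinh_eq, Real.cosh_eq, h, Real.exp_neg]
  have := Real.exp_pos x
  field_simp

lemma hasSum_sq_log_tanh {x : ℝ} (hx : 0 < x) :
    HasSum (fun n : ℕ => 4 * oddHarmonic n / n * Real.exp (-(4 * n) * x))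
      (Real.log (Real.tanh x) ^ 2) := by
  have h1 : Real.exp (-2 * x) < 1 := by rw [Real.exp_lt_one_iff]; linarith
  have h0 := Real.exp_pos (-2 * x)
  have := hasSum_sq_log_sub_log h0.le h1
  rw [tanh_eq_one_sub_div_one_add, Real.log_div (by linarith) (by linarith), ← neg_sq, neg_sub]
  refine this.congr_fun fun n => ?_
  rw [← Real.exp_nat_mul]
  congr 2
  push_cast
  ring

lemma oddHarmonic_nonneg (n : ℕ) : 0 ≤ oddHarmonic n := by
  rw [oddHarmonic_eq_sum_range]; positivity

lemma oddHarmonic_le (n : ℕ) : oddHarmonic n ≤ 1 + Real.log n := by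
  refine le_trans ?_ (harmonic_le_one_add_log n)
  rw [oddHarmonic_eq_sum_range, harmonic]
  push_cast
  refine Finset.sum_le_sum fun k _ => ?_
  rw [one_div]
  gcongr
  linarith [(Nat.cast_nonneg k : (0 : ℝ) ≤ k)]

lemma LSeriesSummable_hZetaCoeff {s : ℂ} (hs : 1 < s.re) : LSeriesSummable hZetaCoeff s := by
  obtain ⟨x, hx1, hx⟩ := exists_between hs
  refine LSeriesSummable_of_isBigO_rpow hx ?_
  have hx0 : 0 < x - 1 := by linarith
  have h1 : (fun n : ℕ => (1 : ℝ) + Real.log n) =O[atTop] fun n : ℕ => (n : ℝ) ^ (x - 1) := by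
    refine IsBigO.add ?_ ?_
    · refine IsBigO.of_bound 1 ?_
      filter_upwards [eventually_ge_atTop 1] with n hn
      have : (1 : ℝ) ≤ (n : ℝ) ^ (x - 1) := Real.one_le_rpow (by exact_mod_cast hn) hx0.le
      rw [one_mul, norm_one]
      exact this.trans (le_abs_self _)
    · exact (isLittleO_log_rpow_atTop hx0).isBigO.comp_tendsto tendsto_natCast_atTop_atTop
  refine IsBigO.trans (IsBigO.of_bound 1 (Eventually.of_forall fun n => ?_)) h1
  rw [hZetaCoeff, Complex.norm_real, one_mul, Real.norm_eq_abs, abs_of_nonneg (oddHarmonic_nonneg n)]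
  exact (oddHarmonic_le n).trans (le_abs_self _)

/-- The function `log² (tanh x)`, as a complex-valued function. -/
noncomputable def sqLogTanh (x : ℝ) : ℂ := ((Real.log (Real.tanh x) ^ 2 : ℝ) : ℂ)

lemma hasSum_mellin_sqLogTanh {w : ℂ} (hw : 0 < w.re) :
    HasSum (fun n : ℕ => Complex.Gamma w * ((4 * oddHarmonic n / n : ℝ) : ℂ) / ((4 * n : ℝ) : ℂ) ^ w)
      (mellin sqLogTanh w) := by
  refine hasSum_mellin (p := fun n : ℕ => (4 * n : ℝ)) (fun n => ?_) hw (fun t ht => ?_) ?_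
  · rcases Nat.eq_zero_or_pos n with rfl | hn
    · left; simp
    · right; positivity
  · have := Complex.hasSum_ofReal.2 (hasSum_sq_log_tanh ht)
    refine this.congr_fun fun n => ?_
    push_cast
    rfl
  -- Up to the constant 4/4^{Re w}, the required norm series is the Dirichlet series at w + 1.
  · have h := (LSeriesSummable_hZetaCoeff (s := w + 1) (by simpa using hw)).norm
    refine (h.mul_left (4 / (4 : ℝ) ^ w.re)).congr fun n => ?_
    rcases Nat.eq_zero_or_pos n with rfl | hn
    · simp
    · have hn' : (0 : ℝ) < n := by positivity
      rw [LSeries.norm_term_eq, if_neg hn.ne', hZetaCoeff, Complex.norm_real, Complex.norm_real,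
        Real.norm_of_nonneg (oddHarmonic_nonneg n), Real.norm_of_nonneg
          (by have := oddHarmonic_nonneg n; positivity), Real.mul_rpow (by norm_num) hn'.le,
        Complex.add_re, Complex.one_re, Real.rpow_add hn', Real.rpow_one]
      field_simp

lemma hZeta_eq_mellin {s : ℂ} (hs : 1 < s.re) :
    hZeta s = (4 : ℂ) ^ (s - 2) * (Complex.Gamma (s - 1))⁻¹ * mellin sqLogTanh (s - 1) := by
  have hw : 0 < (s - 1).re := by simpa using hs
  have hG := Complex.Gamma_ne_zero_of_re_pos hw
  have h := (hasSum_mellin_sqLogTanh hw).mul_left ((4 : ℂ) ^ (s - 2) * (Complex.Gamma (s - 1))⁻¹)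
  rw [← h.tsum_eq, hZeta, LSeries]
  refine tsum_congr fun n => ?_
  rcases Nat.eq_zero_or_pos n with rfl | hn
  · simp
  · have hn' : (n : ℂ) ≠ 0 := by exact_mod_cast hn.ne'
    have h4 : (4 : ℂ) ^ (s - 1) = 4 ^ (s - 2) * 4 := by
      rw [show s - 1 = (s - 2) + 1 by ring, Complex.cpow_add _ _ (by norm_num), Complex.cpow_one]
    have hnn : (n : ℂ) ^ s = n ^ (s - 1) * n := by
      conv_lhs => rw [show s = (s - 1) + 1 by ring, Complex.cpow_add _ _ hn', Complex.cpow_one]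
    have h40 : (4 : ℂ) ^ (s - 2) ≠ 0 := by simp [Complex.cpow_eq_zero_iff]
    have hn0 : (n : ℂ) ^ (s - 1) ≠ 0 := by simp [Complex.cpow_eq_zero_iff, hn']
    rw [LSeries.term_of_ne_zero hn.ne', hZetaCoeff, Complex.ofReal_mul,
      Complex.mul_cpow_ofReal_nonneg (by norm_num) (Nat.cast_nonneg n), hnn]
    push_cast
    rw [h4]
    field_simp

/-! ### Mellin transforms of truncated log-power terms. -/

/-- `f` vanishes near `∞`, is `O(t ^ (k - ε))` at `0`, and has Mellin transform `m` on the half plane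
`-k < Re w`. -/
structure IsMellinPiece (k : ℝ) (f : ℝ → ℂ) (m : ℂ → ℂ) : Prop where
  locallyIntegrableOn : MeasureTheory.LocallyIntegrableOn f (Set.Ioi 0)
  eventually_eq_zero : ∀ᶠ t in atTop, f t = 0
  isBigO_zero : ∀ b : ℝ, -k < b → f =O[𝓝[>] 0] (· ^ (-b))
  mellin_eq : ∀ w : ℂ, -k < w.re → mellin f w = m w

namespace IsMellinPiece

variable {k : ℝ} {f g : ℝ → ℂ} {m m' : ℂ → ℂ} {w : ℂ}

lemma isBigO_top (hf : IsMellinPiece k f m) (a : ℝ) : f =O[atTop] (· ^ (-a)) :=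
  (show f =ᶠ[atTop] fun _ => 0 from hf.eventually_eq_zero).trans_isBigO
    (Asymptotics.isBigO_zero _ _)

lemma mellinConvergent (hf : IsMellinPiece k f m) (hw : -k < w.re) : MellinConvergent f w := by
  obtain ⟨b, hb, hbw⟩ := exists_between hw
  exact mellinConvergent_of_isBigO_rpow hf.locallyIntegrableOn (hf.isBigO_top (w.re + 1))
    (lt_add_one _) (hf.isBigO_zero b hb) hbw

/-- Multiplication by log t differentiates the Mellin transform in w; the bound at 0 survives
because every exponent above -k is allowed. -/
lemma log_smul (hf : IsMellinPiece k f m)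
    (hm : ∀ w : ℂ, -k < w.re → HasDerivAt m (m' w) w) :
    IsMellinPiece k (fun t => Real.log t • f t) m' where
  locallyIntegrableOn := by
    refine hf.locallyIntegrableOn.continuousOn_smul isOpen_Ioi.isLocallyClosed ?_
    exact Real.continuousOn_log.mono fun t ht => ne_of_gt ht
  eventually_eq_zero := hf.eventually_eq_zero.mono fun t ht => by simp [ht]
  isBigO_zero b hb := by
    obtain ⟨b', hb', hbb⟩ := exists_between hb
    exact isBigO_rpow_zero_log_smul hbb (hf.isBigO_zero b' hb')
  mellin_eq w hw := by
    obtain ⟨b, hb, hbw⟩ := exists_between hw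
    have h := (mellin_hasDerivAt_of_isBigO_rpow hf.locallyIntegrableOn (hf.isBigO_top (w.re + 1))
      (lt_add_one _) (hf.isBigO_zero b hb) hbw).2
    refine h.unique ((hm w hw).congr_of_eventuallyEq ?_)
    filter_upwards [(isOpen_lt continuous_const Complex.continuous_re).mem_nhds hw] with z hz
    exact hf.mellin_eq z hz

lemma const_mul (hf : IsMellinPiece k f m) (c : ℂ) :
    IsMellinPiece k (fun t => c * f t) (fun w => c * m w) where
  locallyIntegrableOn := hf.locallyIntegrableOn.smul c
  eventually_eq_zero := hf.eventually_eq_zero.mono fun t ht => by simp [ht]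
  isBigO_zero b hb := (hf.isBigO_zero b hb).const_mul_left c
  mellin_eq w hw := by
    rw [← hf.mellin_eq w hw]
    exact mellin_const_smul f w c

lemma add (hf : IsMellinPiece k f m) (hg : IsMellinPiece k g m') :
    IsMellinPiece k (fun t => f t + g t) (fun w => m w + m' w) where
  locallyIntegrableOn := hf.locallyIntegrableOn.add hg.locallyIntegrableOn
  eventually_eq_zero := by
    filter_upwards [hf.eventually_eq_zero, hg.eventually_eq_zero] with t h1 h2
    rw [h1, h2, add_zero]
  isBigO_zero b hb := (hf.isBigO_zero b hb).add (hg.isBigO_zero b hb)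
  mellin_eq w hw := by
    rw [← hf.mellin_eq w hw, ← hg.mellin_eq w hw]
    exact (hasMellin_add (hf.mellinConvergent hw) (hg.mellinConvergent hw)).2

end IsMellinPiece

lemma locallyIntegrableOn_indicator_Ioc {f : ℝ → ℂ} (hf : ContinuousOn f (Set.Ioi 0)) :
    MeasureTheory.LocallyIntegrableOn (Set.indicator (Set.Ioc 0 1) f) (Set.Ioi 0) := by
  intro x hx
  obtain ⟨u, hu, h⟩ :=
    hf.locallyIntegrableOn (μ := MeasureTheory.volume) measurableSet_Ioi x hx
  exact ⟨u, hu, h.indicator measurableSet_Ioc⟩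

/-- The function `(a + b log t + c log² t) t ^ k` cut off to `(0, 1]`. -/
noncomputable def logPowCutoff (a b c : ℂ) (k : ℕ) : ℝ → ℂ :=
  Set.indicator (Set.Ioc 0 1) fun t =>
    (a + b * (Real.log t : ℂ) + c * (Real.log t : ℂ) ^ 2) * (t : ℂ) ^ k

/-- The Mellin transform of `logPowCutoff`. -/
noncomputable def principalPart (a b c : ℂ) (k : ℕ) (w : ℂ) : ℂ :=
  a / (w + k) - b / (w + k) ^ 2 + 2 * c / (w + k) ^ 3

lemma isMellinPiece_pow (k : ℕ) :
    IsMellinPiece k (Set.indicator (Set.Ioc 0 1) fun t : ℝ => (t : ℂ) ^ k) (fun w => 1 / (w + k))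
    where
  locallyIntegrableOn := locallyIntegrableOn_indicator_Ioc (by fun_prop)
  eventually_eq_zero := by
    filter_upwards [eventually_gt_atTop 1] with t ht
    exact Set.indicator_of_notMem (fun h => absurd h.2 (not_le.2 ht)) _
  isBigO_zero b hb := by
    refine IsBigO.of_bound 1 ?_
    filter_upwards [Ioo_mem_nhdsGT (zero_lt_one' ℝ)] with t ht
    rw [Set.indicator_of_mem (show t ∈ Set.Ioc (0 : ℝ) 1 from ⟨ht.1, ht.2.le⟩), one_mul, norm_pow,
      Complex.norm_real, Real.norm_of_nonneg ht.1.le, Real.norm_of_nonneg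
      (Real.rpow_nonneg ht.1.le _), ← Real.rpow_natCast]
    exact Real.rpow_le_rpow_of_exponent_ge ht.1 ht.2.le (by linarith)
  mellin_eq w hw := by
    have := (hasMellin_cpow_Ioc (k : ℂ) (s := w) (by rw [Complex.natCast_re]; linarith)).2
    simpa using this

/-- Differentiate 1/(w+k) twice. -/
lemma isMellinPiece_logPowCutoff (a b c : ℂ) (k : ℕ) :
    IsMellinPiece k (logPowCutoff a b c k) (principalPart a b c k) := by
  have hne : ∀ w : ℂ, -(k : ℝ) < w.re → w + k ≠ 0 := fun w hw h => by
    have := congrArg Complex.re h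
    simp at this
    linarith
  have h0 := isMellinPiece_pow k
  have hd (w : ℂ) : HasDerivAt (fun w : ℂ => w + k) 1 w := (hasDerivAt_id w).add_const _
  have h1 := h0.log_smul (m' := fun w => -1 / (w + k) ^ 2) fun w hw => by
    simpa using (hd w).fun_inv (hne w hw)
  have h2 := h1.log_smul (m' := fun w => 2 / (w + k) ^ 3) fun w hw => by
    have hw' := hne w hw
    convert! (((hd w).fun_pow 2).fun_inv (pow_ne_zero 2 hw')).neg using 1
    · ext z; simp [neg_div]
    · push_cast
      field_simp
  convert! ((h0.const_mul a).add (h1.const_mul b)).add (h2.const_mul c) using 1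
  · ext t
    by_cases ht : t ∈ Set.Ioc (0 : ℝ) 1
    · simp only [logPowCutoff, Set.indicator_of_mem ht, Complex.real_smul]
      ring
    · simp [logPowCutoff, Set.indicator_of_notMem ht]
  · ext w
    simp only [principalPart]
    ring

/-! ### Continuation from an asymptotic expansion at 0. -/

section Continuation

variable {f : ℝ → ℂ} {a b c : ℕ → ℂ}

/-- `f` minus the first `N` terms of its asymptotic expansion at `0`, cut off to `(0, 1]`. -/
noncomputable def mellinRemainder (f : ℝ → ℂ) (a b c : ℕ → ℂ) (N : ℕ) (t : ℝ) : ℂ :=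
  f t - ∑ k ∈ Finset.range N, logPowCutoff (a k) (b k) (c k) k t

lemma mellinRemainder_zero (f : ℝ → ℂ) (a b c : ℕ → ℂ) : mellinRemainder f a b c 0 = f := by
  ext t
  simp [mellinRemainder]

lemma mellinRemainder_eq_add (f : ℝ → ℂ) (a b c : ℕ → ℂ) (N : ℕ) :
    mellinRemainder f a b c N = fun t =>
      mellinRemainder f a b c (N + 1) t + logPowCutoff (a N) (b N) (c N) N t := by
  ext t
  simp only [mellinRemainder, Finset.sum_range_succ]
  ring

/-- The continuation of the Mellin transform of `f` to `1 / 2 - N < Re w`. -/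
noncomputable def mellinStep (f : ℝ → ℂ) (a b c : ℕ → ℂ) (N : ℕ) (w : ℂ) : ℂ :=
  mellin (mellinRemainder f a b c N) w +
    ∑ k ∈ Finset.range N, principalPart (a k) (b k) (c k) k w

/-- `f` has the asymptotic expansion `∑ (a k + b k log t + c k log² t) t ^ k` at `0⁺` and
decays exponentially at `∞`. -/
structure HasLogExpansion (f : ℝ → ℂ) (a b c : ℕ → ℂ) : Prop where
  locallyIntegrableOn : MeasureTheory.LocallyIntegrableOn f (Set.Ioi 0)
  isBigO_exp : f =O[atTop] fun t => Real.exp (-1 * t)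
  isBigO_zero : ∀ N : ℕ, (fun t : ℝ => f t - ∑ k ∈ Finset.range N,
    (a k + b k * (Real.log t : ℂ) + c k * (Real.log t : ℂ) ^ 2) * (t : ℂ) ^ k)
      =O[𝓝[>] 0] fun t => t ^ (-(1 / 2 - (N : ℝ)))

namespace HasLogExpansion

lemma remainder_locallyIntegrableOn (hf : HasLogExpansion f a b c) (N : ℕ) :
    MeasureTheory.LocallyIntegrableOn (mellinRemainder f a b c N) (Set.Ioi 0) := by
  induction N with
  | zero => rw [mellinRemainder_zero]; exact hf.locallyIntegrableOn
  | succ N ih =>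
    have := ih.sub (isMellinPiece_logPowCutoff (a N) (b N) (c N) N).locallyIntegrableOn
    convert! this using 1
    ext t
    simp only [mellinRemainder, Finset.sum_range_succ, Pi.sub_apply]
    ring

lemma remainder_isBigO_exp (hf : HasLogExpansion f a b c) (N : ℕ) :
    mellinRemainder f a b c N =O[atTop] fun t => Real.exp (-1 * t) := by
  refine hf.isBigO_exp.congr' ?_ EventuallyEq.rfl
  filter_upwards [eventually_gt_atTop 1] with t ht
  rw [mellinRemainder, Finset.sum_eq_zero, sub_zero]
  intro k _
  exact Set.indicator_of_notMem (fun h => absurd h.2 (not_le.2 ht)) _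

lemma remainder_isBigO_zero (hf : HasLogExpansion f a b c) (N : ℕ) :
    mellinRemainder f a b c N =O[𝓝[>] 0] fun t => t ^ (-(1 / 2 - (N : ℝ))) := by
  refine (hf.isBigO_zero N).congr' ?_ EventuallyEq.rfl
  filter_upwards [Ioo_mem_nhdsGT (zero_lt_one' ℝ)] with t ht
  rw [mellinRemainder]
  congr 1
  refine Finset.sum_congr rfl fun k _ => ?_
  rw [logPowCutoff, Set.indicator_of_mem (show t ∈ Set.Ioc (0 : ℝ) 1 from ⟨ht.1, ht.2.le⟩)]

lemma remainder_mellinConvergent (hf : HasLogExpansion f a b c) {N : ℕ} {w : ℂ}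
    (hw : 1 / 2 - (N : ℝ) < w.re) : MellinConvergent (mellinRemainder f a b c N) w :=
  mellinConvergent_of_isBigO_rpow_exp one_pos (hf.remainder_locallyIntegrableOn N)
    (hf.remainder_isBigO_exp N) (hf.remainder_isBigO_zero N) hw

lemma remainder_analyticAt (hf : HasLogExpansion f a b c) {N : ℕ} {w : ℂ}
    (hw : 1 / 2 - (N : ℝ) < w.re) : AnalyticAt ℂ (mellin (mellinRemainder f a b c N)) w := by
  have ho : IsOpen {z : ℂ | 1 / 2 - (N : ℝ) < z.re} := isOpen_lt continuous_const Complex.continuous_re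
  refine DifferentiableOn.analyticAt (s := {z : ℂ | 1 / 2 - (N : ℝ) < z.re}) (fun z hz => ?_)
    (ho.mem_nhds hw)
  exact (mellin_differentiableAt_of_isBigO_rpow_exp one_pos (hf.remainder_locallyIntegrableOn N)
    (hf.remainder_isBigO_exp N) (hf.remainder_isBigO_zero N) hz).differentiableWithinAt

/-- On this half plane the N-th cutoff term has a convergent transform, so it can be moved between
the integral and the explicit sum. -/
lemma step_succ (hf : HasLogExpansion f a b c) {N : ℕ} {w : ℂ} (hw : -(N : ℝ) < w.re) :
    mellinStep f a b c (N + 1) w = mellinStep f a b c N w := by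
  have hp := isMellinPiece_logPowCutoff (a N) (b N) (c N) N
  have hr := hf.remainder_mellinConvergent (N := N + 1) (w := w) (by push_cast; linarith)
  have h := (hasMellin_add hr (hp.mellinConvergent hw)).2
  rw [hp.mellin_eq w hw] at h
  rw [mellinStep, mellinStep, mellinRemainder_eq_add f a b c N, h, Finset.sum_range_succ]
  ring

lemma step_eq_of_le (hf : HasLogExpansion f a b c) {N N' : ℕ} (h : N ≤ N') {w : ℂ}
    (hw : 1 / 2 - (N : ℝ) < w.re) : mellinStep f a b c N' w = mellinStep f a b c N w := by
  induction N', h using Nat.le_induction with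
  | base => rfl
  | succ n hn ih =>
    have : (N : ℝ) ≤ n := by exact_mod_cast hn
    rw [hf.step_succ (by linarith), ih]

lemma mellinConvergent (hf : HasLogExpansion f a b c) {w : ℂ} (hw : 0 < w.re) :
    MellinConvergent f w := by
  have h := mellinRemainder_eq_add f a b c 0
  rw [mellinRemainder_zero] at h
  rw [h]
  -- The order-0 bound would only give Re w > 1/2; splitting off the k = 0 term reaches Re w > 0.
  exact (hasMellin_add (hf.remainder_mellinConvergent (N := 1) (by push_cast; linarith))
    ((isMellinPiece_logPowCutoff _ _ _ 0).mellinConvergent (by simpa using hw))).1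

/-- The meromorphic continuation of the Mellin transform of a function with a log-power
expansion at `0`. -/
theorem exists_continuation (hf : HasLogExpansion f a b c) :
    ∃ M : ℂ → ℂ, (∀ w : ℂ, 0 < w.re → M w = mellin f w) ∧
      ∀ (N : ℕ) (w : ℂ), 1 / 2 - (N : ℝ) < w.re → ∃ g : ℂ → ℂ, AnalyticAt ℂ g w ∧
        ∀ᶠ z in 𝓝 w, M z = g z + ∑ k ∈ Finset.range N, principalPart (a k) (b k) (c k) k z := by
  -- The level depends on the point, chosen so that w lies in its half plane; `key` shows that any
  -- other admissible level gives the same value.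
  let n : ℂ → ℕ := fun w => ⌈|w.re|⌉₊ + 1
  have hn : ∀ w : ℂ, 1 / 2 - (n w : ℝ) < w.re := fun w => by
    have h1 : |w.re| ≤ ⌈|w.re|⌉₊ := Nat.le_ceil _
    have h2 := neg_abs_le w.re
    simp only [n]
    push_cast
    linarith
  have key : ∀ (N : ℕ) (w : ℂ), 1 / 2 - (N : ℝ) < w.re →
      mellinStep f a b c (n w) w = mellinStep f a b c N w := fun N w hw => by
    rcases le_total N (n w) with h | h
    · exact hf.step_eq_of_le h hw
    · exact (hf.step_eq_of_le h (hn w)).symm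
  refine ⟨fun w => mellinStep f a b c (n w) w, fun w hw => ?_, fun N w hw => ?_⟩
  · change mellinStep f a b c (n w) w = _
    rw [key 1 w (by push_cast; linarith), hf.step_succ (by simpa using hw)]
    simp [mellinStep, mellinRemainder_zero]
  · refine ⟨_, hf.remainder_analyticAt hw, ?_⟩
    filter_upwards [(isOpen_lt continuous_const Complex.continuous_re).mem_nhds hw] with z hz
    exact key N z hz

end HasLogExpansion

end Continuation

/-! ### Taylor series as formal power series. -/

/-- The Taylor series at `0`. -/
noncomputable def taylorSeries (f : ℝ → ℝ) : PowerSeries ℝ :=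
  PowerSeries.mk fun n => iteratedDeriv n f 0 / n.factorial

section TaylorSeries

variable {f g : ℝ → ℝ}

lemma taylorSeries_mul (hf : AnalyticAt ℝ f 0) (hg : AnalyticAt ℝ g 0) :
    taylorSeries (f * g) = taylorSeries f * taylorSeries g := by
  ext n
  simp only [taylorSeries, PowerSeries.coeff_mk, PowerSeries.coeff_mul,
    iteratedDeriv_mul hf.contDiffAt hg.contDiffAt, Finset.sum_div,
    Finset.Nat.sum_antidiagonal_eq_sum_range_succ_mk, Nat.succ_eq_add_one]
  refine Finset.sum_congr rfl fun i hi ↦ ?_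
  rw [Nat.cast_choose _ (by grind)]
  field_simp [Nat.factorial_ne_zero]

lemma taylorSeries_add (hf : AnalyticAt ℝ f 0) (hg : AnalyticAt ℝ g 0) :
    taylorSeries (f + g) = taylorSeries f + taylorSeries g := by
  ext n
  simp only [taylorSeries, PowerSeries.coeff_mk, map_add]
  rw [iteratedDeriv_add hf.contDiffAt hg.contDiffAt, add_div]

lemma taylorSeries_const (c : ℝ) : taylorSeries (fun _ => c) = PowerSeries.C c := by
  ext n
  simp only [taylorSeries, PowerSeries.coeff_mk, PowerSeries.coeff_C, iteratedDeriv_const]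
  split_ifs with h <;> simp [h]

lemma taylorSeries_id : taylorSeries (fun x => x) = PowerSeries.X := by
  ext n
  simp only [taylorSeries, PowerSeries.coeff_mk, PowerSeries.coeff_X, iteratedDeriv_fun_id_zero]
  split_ifs with h <;> simp [h]

lemma taylorSeries_exp (c : ℝ) :
    taylorSeries (fun x => Real.exp (c * x)) = PowerSeries.rescale c (PowerSeries.exp ℝ) := by
  ext n
  simp [taylorSeries, PowerSeries.coeff_rescale, PowerSeries.coeff_exp, div_eq_mul_inv]

lemma coeff_taylorSeries_deriv (f : ℝ → ℝ) (n : ℕ) :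
    (taylorSeries (deriv f)).coeff n = (n + 1) * (taylorSeries f).coeff (n + 1) := by
  simp only [taylorSeries, PowerSeries.coeff_mk, iteratedDeriv_succ', Nat.factorial_succ]
  push_cast
  field_simp

lemma coeff_taylorSeries_eq_zero_of_even (hf : ∀ x, f (-x) = f x) {n : ℕ} (hn : Odd n) :
    (taylorSeries f).coeff n = 0 := by
  have h := iteratedDeriv_comp_neg n f 0
  simp only [hf, hn.neg_one_pow, neg_zero, neg_smul, one_smul] at h
  simp [taylorSeries, (by linarith : iteratedDeriv n f 0 = 0)]

lemma coeff_zero_taylorSeries (f : ℝ → ℝ) : (taylorSeries f).coeff 0 = f 0 := by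
  simp [taylorSeries]

lemma isBigO_sub_taylorSeries (hf : AnalyticAt ℝ f 0) (N : ℕ) :
    (fun x => f x - ∑ k ∈ Finset.range N, (taylorSeries f).coeff k * x ^ k)
      =O[𝓝 0] fun x => x ^ N := by
  have h := hf.hasFPowerSeriesAt.isBigO_sub_partialSum_pow N
  refine (h.congr_left fun x => ?_).trans (IsBigO.of_bound 1 (Eventually.of_forall fun x => ?_))
  · simp [FormalMultilinearSeries.partialSum, taylorSeries, FormalMultilinearSeries.ofScalars]
  · simp

end TaylorSeries

/-! ### The function log(tanh x / x) and Bernoulli polynomials at 1/2. -/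

/-- The even analytic function `log (tanh x / x)`. -/
noncomputable def logTanhDiv (x : ℝ) : ℝ := Real.log (dslope Real.tanh 0 x)

lemma tanh_ne_zero {x : ℝ} (hx : x ≠ 0) : Real.tanh x ≠ 0 := fun h =>
  hx (Real.tanh_injective (by rw [h, Real.tanh_zero]))

lemma dslope_tanh_of_ne {x : ℝ} (hx : x ≠ 0) : dslope Real.tanh 0 x = Real.tanh x / x := by
  rw [dslope_of_ne _ hx, slope_def_field, Real.tanh_zero, sub_zero, sub_zero]

/-- Valid for negative x too, since `Real.log` is log|·|. -/
lemma logTanhDiv_of_ne {x : ℝ} (hx : x ≠ 0) :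
    logTanhDiv x = Real.log (Real.tanh x) - Real.log x := by
  rw [logTanhDiv, dslope_tanh_of_ne hx, Real.log_div (tanh_ne_zero hx) hx]

lemma analyticAt_tanh (x : ℝ) : AnalyticAt ℝ Real.tanh x := by
  have : Real.tanh = fun x => Real.sinh x / Real.cosh x := funext Real.tanh_eq_sinh_div_cosh
  rw [this]
  exact Real.analyticAt_sinh.div Real.analyticAt_cosh (Real.cosh_pos x).ne'

lemma hasDerivAt_tanh (x : ℝ) : HasDerivAt Real.tanh (1 / Real.cosh x ^ 2) x := by
  have : Real.tanh = fun x => Real.sinh x / Real.cosh x := funext Real.tanh_eq_sinh_div_cosh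
  rw [this]
  convert! (Real.hasDerivAt_sinh x).div (Real.hasDerivAt_cosh x) (Real.cosh_pos x).ne' using 1
  rw [← Real.cosh_sq_sub_sinh_sq x]
  ring

lemma dslope_tanh_zero : dslope Real.tanh 0 0 = 1 := by
  rw [dslope_same, (hasDerivAt_tanh 0).deriv]
  simp

lemma logTanhDiv_zero : logTanhDiv 0 = 0 := by
  rw [logTanhDiv, dslope_tanh_zero, Real.log_one]

lemma logTanhDiv_neg (x : ℝ) : logTanhDiv (-x) = logTanhDiv x := by
  rcases eq_or_ne x 0 with rfl | hx
  · rw [neg_zero]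
  · rw [logTanhDiv_of_ne hx, logTanhDiv_of_ne (neg_ne_zero.2 hx), Real.tanh_neg, Real.log_neg_eq_log,
      Real.log_neg_eq_log]

lemma analyticAt_logTanhDiv : AnalyticAt ℝ logTanhDiv 0 := by
  obtain ⟨p, hp⟩ := analyticAt_tanh 0
  have h : AnalyticAt ℝ (dslope Real.tanh 0) 0 := hp.has_fpower_series_dslope_fslope.analyticAt
  exact h.log (by rw [dslope_tanh_zero]; exact one_pos)

/-- For x ≠ 0 the first factor is x (log tanh)'(x) = x/(sinh x cosh x). Clearing denominators makes
the identity hold at 0 as well, so Taylor series can be taken on both sides. -/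
lemma one_add_mul_deriv_logTanhDiv (x : ℝ) :
    (1 + x * deriv logTanhDiv x) * (Real.exp (4 * x) + -1) = 4 * x * Real.exp (2 * x) := by
  rcases eq_or_ne x 0 with rfl | hx
  · simp
  have h : HasDerivAt logTanhDiv (1 / Real.cosh x ^ 2 / Real.tanh x - 1 / x) x := by
    have := ((hasDerivAt_tanh x).log (tanh_ne_zero hx)).sub (Real.hasDerivAt_log hx)
    rw [← one_div] at this
    refine this.congr_of_eventuallyEq ?_
    filter_upwards [isOpen_ne.mem_nhds hx] with y hy
    exact logTanhDiv_of_ne hy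
  have hs : Real.sinh x ≠ 0 := by simpa using hx
  have hc := (Real.cosh_pos x).ne'
  have h2 : Real.exp (4 * x) + -1 = 4 * Real.exp (2 * x) * (Real.sinh x * Real.cosh x) := by
    have e4 : Real.exp (4 * x) = Real.exp x ^ 4 := by rw [← Real.exp_nat_mul]; norm_num
    have e2 : Real.exp (2 * x) = Real.exp x ^ 2 := by rw [← Real.exp_nat_mul]; norm_num
    have := (Real.exp_pos x).ne'
    rw [Real.sinh_eq, Real.cosh_eq, Real.exp_neg, e4, e2]
    field_simp
    ring
  rw [h.deriv, h2, Real.tanh_eq_sinh_div_cosh]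
  field_simp
  ring

lemma taylorSeries_logTanhDiv_deriv :
    1 + PowerSeries.X * taylorSeries (deriv logTanhDiv) =
      PowerSeries.rescale (4 : ℝ) (PowerSeries.mk fun n =>
        Polynomial.aeval (1 / 2 : ℝ) ((1 / n.factorial : ℚ) • Polynomial.bernoulli n)) := by
  have hd := analyticAt_logTanhDiv.deriv
  have hx : AnalyticAt ℝ (fun x : ℝ => x) 0 := analyticAt_id
  have he (c : ℝ) : AnalyticAt ℝ (fun x : ℝ => Real.exp (c * x)) 0 := by fun_prop
  have h1 := congrArg taylorSeries (show ((fun _ => 1) + (fun x => x) * deriv logTanhDiv) *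
      ((fun x => Real.exp (4 * x)) + fun _ => -1) =
      (fun _ => (4 : ℝ)) * (fun x => x) * (fun x => Real.exp (2 * x)) from
    funext one_add_mul_deriv_logTanhDiv)
  rw [taylorSeries_mul (analyticAt_const.add (hx.mul hd)) ((he 4).add analyticAt_const),
    taylorSeries_add analyticAt_const (hx.mul hd), taylorSeries_add (he 4) analyticAt_const,
    taylorSeries_mul hx hd, taylorSeries_mul (analyticAt_const.mul hx) (he 2),
    taylorSeries_mul analyticAt_const hx, taylorSeries_const, taylorSeries_const,
    taylorSeries_const, taylorSeries_id, taylorSeries_exp, taylorSeries_exp] at h1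
  have h2 := congrArg (PowerSeries.rescale (4 : ℝ))
    (Polynomial.bernoulli_generating_function (1 / 2 : ℝ))
  rw [map_mul, map_mul, map_sub, map_one, PowerSeries.rescale_rescale, PowerSeries.rescale_X] at h2
  norm_num at h1 h2
  rw [← sub_eq_add_neg] at h1
  -- Power series over ℝ form a domain, and e^{4X} - 1 is nonzero because its X-coefficient is 4.
  refine mul_right_cancel₀ (b := PowerSeries.rescale (4 : ℝ) (PowerSeries.exp ℝ) - 1) ?_ ?_
  · intro h
    have := congrArg (PowerSeries.coeff 1) h
    simp [PowerSeries.coeff_rescale, PowerSeries.coeff_exp, PowerSeries.coeff_one] at this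
  · rw [h1]
    norm_num
    rw [h2]

lemma coeff_taylorSeries_logTanhDiv {n : ℕ} (hn : 1 ≤ n) :
    n * (taylorSeries logTanhDiv).coeff n =
      4 ^ n * (((Polynomial.bernoulli n).eval (1 / 2 : ℚ) : ℚ) : ℝ) / n.factorial := by
  obtain ⟨m, rfl⟩ := Nat.exists_eq_add_of_le' hn
  have h := congrArg (PowerSeries.coeff (m + 1)) taylorSeries_logTanhDiv_deriv
  have ha : Polynomial.aeval (1 / 2 : ℝ) (Polynomial.bernoulli (m + 1)) =
      (((Polynomial.bernoulli (m + 1)).eval (1 / 2 : ℚ) : ℚ) : ℝ) := by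
    have := Polynomial.aeval_algebraMap_apply ℝ (1 / 2 : ℚ) (Polynomial.bernoulli (m + 1))
    simpa using this
  rw [map_add, PowerSeries.coeff_succ_X_mul, coeff_taylorSeries_deriv, PowerSeries.coeff_rescale,
    PowerSeries.coeff_mk, map_smul, ha, PowerSeries.coeff_one, if_neg (by omega), zero_add] at h
  rw [Nat.cast_succ, h, Rat.smul_def]
  push_cast
  ring

/-- By the Fourier series, B_{2n}(1/2) is a multiple of Σ (-1)^m/m^{2n}. If it vanished, Σ (1/m² -
(-1)^m/m^{2n}) would equal π²/6 < 2, yet its terms are nonnegative and the one at m = 1 is 2. -/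
lemma bernoulli_eval_half_ne_zero {n : ℕ} (hn : 1 ≤ n) :
    (Polynomial.bernoulli (2 * n)).eval (1 / 2 : ℚ) ≠ 0 := by
  intro h0
  have h := hasSum_one_div_nat_pow_mul_cos (k := n) (by omega) (x := 1 / 2) (by norm_num)
  have he : (Polynomial.map (algebraMap ℚ ℝ) (Polynomial.bernoulli (2 * n))).eval (1 / 2) = 0 := by
    rw [Polynomial.eval_map_algebraMap, show (1 / 2 : ℝ) = algebraMap ℚ ℝ (1 / 2) by norm_num,
      Polynomial.aeval_algebraMap_apply, Polynomial.coe_aeval_eq_eval, h0, map_zero]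
  rw [he, mul_zero] at h
  have hz := le_hasSum (hasSum_zeta_two.sub h) 1 fun m _ => ?_
  · rw [show 2 * Real.pi * ((1 : ℕ) : ℝ) * (1 / 2) = Real.pi by push_cast; ring, Real.cos_pi] at hz
    norm_num at hz
    nlinarith [Real.pi_lt_d2, Real.pi_pos]
  · have hcos := Real.cos_le_one (2 * Real.pi * m * (1 / 2))
    rcases Nat.eq_zero_or_pos m with rfl | hm
    · simp [show n ≠ 0 by omega]
    have hm1 : (1 : ℝ) ≤ m := by exact_mod_cast hm
    have hpow : 1 / (m : ℝ) ^ (2 * n) ≤ 1 / (m : ℝ) ^ 2 :=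
      one_div_le_one_div_of_le (by positivity) (pow_le_pow_right₀ hm1 (by omega))
    have hp : 0 < 1 / (m : ℝ) ^ (2 * n) := by positivity
    nlinarith

/-! ### The log-power expansion of log² tanh. -/

lemma sqLogTanh_isBigO_exp : sqLogTanh =O[atTop] fun t => Real.exp (-1 * t) := by
  refine IsBigO.of_bound 16 ?_
  filter_upwards [eventually_ge_atTop 1] with x hx
  set t := Real.exp (-2 * x) with ht
  have ht0 : 0 < t := Real.exp_pos _
  have ht2 : t ≤ 1 / 2 := by
    have h1 := Real.add_one_le_exp (2 * x)
    rw [ht, neg_mul, Real.exp_neg, one_div]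
    exact inv_anti₀ two_pos (by linarith)
  have hte : t ≤ Real.exp (-1 * x) := Real.exp_le_exp.2 (by linarith)
  have htanh := tanh_eq_one_sub_div_one_add x
  rw [← ht] at htanh
  have hpos : 0 < Real.tanh x := by rw [htanh]; exact div_pos (by linarith) (by linarith)
  have hle : Real.tanh x ≤ 1 := (Real.tanh_lt_one x).le
  have hlow := Real.one_sub_inv_le_log_of_pos hpos
  have hup := Real.log_nonpos hpos.le hle
  -- Together with log y ≥ 1 - 1/y this gives |log tanh x| ≤ 4t, whose square is at most 16t: hence
  -- the constant 16.
  have hinv : -(4 * t) ≤ 1 - (Real.tanh x)⁻¹ := by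
    rw [htanh, inv_div, ← sub_nonneg]
    have : 1 - (1 + t) / (1 - t) - -(4 * t) = 2 * t * (1 - 2 * t) / (1 - t) := by
      field_simp [show (1 - t) ≠ 0 by linarith]
      ring
    rw [this]
    exact div_nonneg (mul_nonneg (by linarith) (by linarith)) (by linarith)
  rw [sqLogTanh, Complex.norm_real, Real.norm_of_nonneg (sq_nonneg _),
    Real.norm_of_nonneg (Real.exp_pos _).le]
  nlinarith

lemma sqLogTanh_locallyIntegrableOn :
    MeasureTheory.LocallyIntegrableOn sqLogTanh (Set.Ioi 0) := by
  refine ContinuousOn.locallyIntegrableOn (fun x hx => ?_) measurableSet_Ioi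
  refine (Complex.continuous_ofReal.continuousAt.comp ?_).continuousWithinAt
  exact ((analyticAt_tanh x).continuousAt.log (tanh_ne_zero (ne_of_gt hx))).pow 2

lemma hasLogExpansion_sqLogTanh : HasLogExpansion sqLogTanh
    (fun k => ((taylorSeries (logTanhDiv * logTanhDiv)).coeff k : ℂ))
    (fun k => ((2 * (taylorSeries logTanhDiv).coeff k : ℝ) : ℂ))
    (fun k => if k = 0 then 1 else 0) where
  locallyIntegrableOn := sqLogTanh_locallyIntegrableOn
  isBigO_exp := sqLogTanh_isBigO_exp
  isBigO_zero N := by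
    have hlin (f : ℝ → ℝ) (hf : AnalyticAt ℝ f 0) :
        (fun x => f x - ∑ k ∈ Finset.range N, (taylorSeries f).coeff k * x ^ k)
          =O[𝓝[>] 0] fun x => x ^ (-(-(N : ℝ))) := by
      refine ((isBigO_sub_taylorSeries hf N).mono nhdsWithin_le_nhds).congr_right fun x => ?_
      rw [neg_neg, Real.rpow_natCast]
    -- The expansion removes log² x entirely once N ≥ 1. For N = 0 each logarithm costs 1/4 in the
    -- exponent, within the allowance 1/2.
    have h1 : (fun x : ℝ => Real.log x ^ 2 * (if N = 0 then 1 else 0))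
        =O[𝓝[>] 0] fun x => x ^ (-(1 / 2 - (N : ℝ))) := by
      split_ifs with hN
      · subst hN
        have h0 : (fun _ : ℝ => (1 : ℝ)) =O[𝓝[>] 0] fun x : ℝ => x ^ (-(0 : ℝ)) := by
          simpa using isBigO_refl (fun _ : ℝ => (1 : ℝ)) (𝓝[>] 0)
        have := isBigO_rpow_zero_log_smul (b := 1 / 2) (by norm_num)
          (isBigO_rpow_zero_log_smul (b := 1 / 4) (by norm_num) h0)
        simpa [sq] using this
      · simpa using isBigO_zero _ _
    have h2 := (isBigO_rpow_zero_log_smul (b := 1 / 2 - (N : ℝ)) (by linarith)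
      (hlin _ analyticAt_logTanhDiv)).const_mul_left 2
    have h3 : (fun x => (logTanhDiv * logTanhDiv) x - ∑ k ∈ Finset.range N,
        (taylorSeries (logTanhDiv * logTanhDiv)).coeff k * x ^ k)
          =O[𝓝[>] 0] fun x => x ^ (-(1 / 2 - (N : ℝ))) := by
      refine (hlin _ (analyticAt_logTanhDiv.mul analyticAt_logTanhDiv)).trans
        (IsBigO.of_bound 1 ?_)
      filter_upwards [Ioo_mem_nhdsGT (zero_lt_one' ℝ)] with t ht
      rw [one_mul, Real.norm_of_nonneg (Real.rpow_nonneg ht.1.le _),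
        Real.norm_of_nonneg (Real.rpow_nonneg ht.1.le _)]
      exact Real.rpow_le_rpow_of_exponent_ge ht.1 ht.2.le (by linarith)
    refine (Complex.isBigO_ofReal_left.2 ((h1.add h2).add h3)).congr' ?_ EventuallyEq.rfl
    filter_upwards [self_mem_nhdsWithin] with x hx
    have hx0 : x ≠ 0 := ne_of_gt hx
    have hl : Real.log (Real.tanh x) = Real.log x + logTanhDiv x := by
      rw [logTanhDiv_of_ne hx0]; ring
    have hc : ∑ k ∈ Finset.range N, (if k = 0 then (1 : ℝ) else 0) * x ^ k =
        1 - if N = 0 then 1 else 0 := by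
      rcases N with _ | N
      · simp
      · simp
    have hsum : ∑ k ∈ Finset.range N, ((taylorSeries (logTanhDiv * logTanhDiv)).coeff k +
          2 * (taylorSeries logTanhDiv).coeff k * Real.log x +
          (if k = 0 then 1 else 0) * Real.log x ^ 2) * x ^ k =
        ∑ k ∈ Finset.range N, (taylorSeries (logTanhDiv * logTanhDiv)).coeff k * x ^ k +
        2 * Real.log x * ∑ k ∈ Finset.range N, (taylorSeries logTanhDiv).coeff k * x ^ k +
        Real.log x ^ 2 * ∑ k ∈ Finset.range N, (if k = 0 then (1 : ℝ) else 0) * x ^ k := by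
      rw [Finset.mul_sum, Finset.mul_sum, ← Finset.sum_add_distrib, ← Finset.sum_add_distrib]
      exact Finset.sum_congr rfl fun k _ => by ring
    have hfin : Real.log x ^ 2 * (if N = 0 then 1 else 0) +
        2 * (Real.log x • (logTanhDiv x -
          ∑ k ∈ Finset.range N, (taylorSeries logTanhDiv).coeff k * x ^ k)) +
        ((logTanhDiv * logTanhDiv) x - ∑ k ∈ Finset.range N,
          (taylorSeries (logTanhDiv * logTanhDiv)).coeff k * x ^ k) =
        Real.log (Real.tanh x) ^ 2 - ∑ k ∈ Finset.range N,
          ((taylorSeries (logTanhDiv * logTanhDiv)).coeff k +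
          2 * (taylorSeries logTanhDiv).coeff k * Real.log x +
          (if k = 0 then 1 else 0) * Real.log x ^ 2) * x ^ k := by
      rw [hsum, hc, hl, Pi.mul_apply, smul_eq_mul]
      ring
    rw [hfin, sqLogTanh]
    push_cast [apply_ite]
    rfl

/-! ### Pole orders, residues and zeros of 1/Γ. -/

lemma AnalyticAt.dslope_self {f : ℂ → ℂ} {z₀ : ℂ} (hf : AnalyticAt ℂ f z₀) :
    AnalyticAt ℂ (dslope f z₀) z₀ := by
  obtain ⟨p, hp⟩ := hf
  exact hp.has_fpower_series_dslope_fslope.analyticAt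

lemma eq_add_mul_dslope (f : ℂ → ℂ) (z₀ z : ℂ) : f z = f z₀ + (z - z₀) * dslope f z₀ z := by
  have := sub_smul_dslope f z₀ z
  rw [smul_eq_mul] at this
  rw [this]
  ring

section Poles

variable {f ψ : ℂ → ℂ} {z₀ : ℂ}

lemma meromorphicAt_of_eventuallyEq_div_pow {m : ℕ} (hψ : AnalyticAt ℂ ψ z₀)
    (h : ∀ᶠ z in 𝓝[≠] z₀, f z = ψ z / (z - z₀) ^ m) : MeromorphicAt f z₀ :=
  MeromorphicAt.congr (f := fun z => ψ z / (z - z₀) ^ m) (hψ.meromorphicAt.div (by fun_prop))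
    (h.mono fun _ hz => hz.symm)

lemma meromorphicOrderAt_of_eventuallyEq_div_pow {m : ℕ} (hψ : AnalyticAt ℂ ψ z₀) (h0 : ψ z₀ ≠ 0)
    (h : ∀ᶠ z in 𝓝[≠] z₀, f z = ψ z / (z - z₀) ^ m) :
    meromorphicOrderAt f z₀ = ((-m : ℤ) : WithTop ℤ) := by
  rw [meromorphicOrderAt_eq_int_iff (meromorphicAt_of_eventuallyEq_div_pow hψ h)]
  refine ⟨ψ, hψ, h0, h.mono fun z hz => ?_⟩
  rw [hz, zpow_neg, zpow_natCast, smul_eq_mul]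
  ring

lemma hasResidueAt_of_simple_pole (hψ : AnalyticAt ℂ ψ z₀)
    (h : ∀ᶠ z in 𝓝[≠] z₀, f z = ψ z / (z - z₀) ^ 1) : HasResidueAt f z₀ (ψ z₀) := by
  refine ⟨0, 0, dslope ψ z₀, hψ.dslope_self, ?_⟩
  filter_upwards [h, self_mem_nhdsWithin] with z hz hne
  have : z - z₀ ≠ 0 := sub_ne_zero.2 hne
  rw [hz, eq_add_mul_dslope ψ z₀ z]
  field_simp
  simp

lemma hasResidueAt_of_double_pole (hψ : AnalyticAt ℂ ψ z₀)
    (h : ∀ᶠ z in 𝓝[≠] z₀, f z = ψ z / (z - z₀) ^ 2) : HasResidueAt f z₀ (deriv ψ z₀) := by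
  -- Two uses of `dslope` expand ψ to second order; the linear coefficient is the residue.
  refine ⟨1, fun _ => ψ z₀, dslope (dslope ψ z₀) z₀, hψ.dslope_self.dslope_self, ?_⟩
  filter_upwards [h, self_mem_nhdsWithin] with z hz hne
  have : z - z₀ ≠ 0 := sub_ne_zero.2 hne
  rw [hz, eq_add_mul_dslope ψ z₀ z, eq_add_mul_dslope (dslope ψ z₀) z₀ z, dslope_same,
    Finset.sum_range_one]
  field_simp
  ring

end Poles

/-- The reciprocal Gamma function has a simple zero at `-k`. -/
lemma exists_one_div_Gamma_eq_mul (k : ℕ) : ∃ H : ℂ → ℂ, Differentiable ℂ H ∧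
    (∀ w : ℂ, (Complex.Gamma w)⁻¹ = (w + k) * H w) ∧ H (-k) = (-1) ^ k * k.factorial := by
  induction k with
  | zero =>
    refine ⟨fun w => (Complex.Gamma (w + 1))⁻¹, ?_, fun w => ?_, by simp⟩
    · exact Complex.differentiable_one_div_Gamma.comp (differentiable_id.add_const 1)
    · rw [Complex.one_div_Gamma_eq_self_mul_one_div_Gamma_add_one, Nat.cast_zero, add_zero]
  | succ k ih =>
    obtain ⟨H, hH, hG, hk⟩ := ih
    refine ⟨fun w => w * H (w + 1), ?_, fun w => ?_, ?_⟩
    · exact differentiable_id.mul (hH.comp (differentiable_id.add_const 1))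
    · rw [Complex.one_div_Gamma_eq_self_mul_one_div_Gamma_add_one, hG]
      push_cast
      ring
    · simp only [Nat.cast_succ, neg_add_rev, neg_add_cancel_comm, Nat.factorial_succ]
      rw [hk]
      push_cast
      ring

lemma analyticAt_principalPart (a b c : ℂ) {k : ℕ} {w : ℂ} (hw : w + k ≠ 0) :
    AnalyticAt ℂ (principalPart a b c k) w := by
  have h : AnalyticAt ℂ (fun w : ℂ => w + k) w := analyticAt_id.add analyticAt_const
  exact ((analyticAt_const.div h hw).sub (analyticAt_const.div (h.pow 2) (pow_ne_zero 2 hw))).add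
    (analyticAt_const.div (h.pow 3) (pow_ne_zero 3 hw))

lemma analyticAt_sum_principalPart {a b c : ℕ → ℂ} {w : ℂ} {s : Finset ℕ}
    (h : ∀ k ∈ s, w + k ≠ 0 ∨ (a k = 0 ∧ b k = 0 ∧ c k = 0)) :
    AnalyticAt ℂ (fun z => ∑ k ∈ s, principalPart (a k) (b k) (c k) k z) w := by
  refine Finset.analyticAt_fun_sum _ fun k hk => ?_
  rcases h k hk with h | ⟨ha, hb, hc⟩
  · exact analyticAt_principalPart _ _ _ h
  · have : principalPart (a k) (b k) (c k) k = fun _ => 0 := by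
      ext z
      simp [principalPart, ha, hb, hc]
    rw [this]
    exact analyticAt_const

section LocalForm

variable {M : ℂ → ℂ} {a b c : ℕ → ℂ}

/-- Near each point, `M` is analytic up to the principal parts in its half plane. -/
def HasPrincipalParts (M : ℂ → ℂ) (a b c : ℕ → ℂ) : Prop :=
  ∀ (N : ℕ) (w : ℂ), 1 / 2 - (N : ℝ) < w.re → ∃ g : ℂ → ℂ, AnalyticAt ℂ g w ∧
    ∀ᶠ z in 𝓝 w, M z = g z + ∑ k ∈ Finset.range N, principalPart (a k) (b k) (c k) k z

lemma HasPrincipalParts.analyticAt (hM : HasPrincipalParts M a b c) {w : ℂ}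
    (h : ∀ k : ℕ, w + k ≠ 0 ∨ (a k = 0 ∧ b k = 0 ∧ c k = 0)) : AnalyticAt ℂ M w := by
  obtain ⟨N, hN⟩ := exists_nat_gt (1 / 2 - w.re)
  obtain ⟨g, hg, hMg⟩ := hM N w (by linarith)
  exact (hg.fun_add (analyticAt_sum_principalPart fun k _ => h k)).congr
    (hMg.mono fun z hz => hz.symm)

lemma HasPrincipalParts.at_neg_nat (hM : HasPrincipalParts M a b c) (n : ℕ) :
    ∃ g : ℂ → ℂ, AnalyticAt ℂ g (-n) ∧
      ∀ᶠ z in 𝓝 (-n : ℂ), M z = g z + principalPart (a n) (b n) (c n) n z := by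
  obtain ⟨g, hg, hMg⟩ := hM (n + 1) (-n) (by simp; linarith)
  refine ⟨_, hg.fun_add (analyticAt_sum_principalPart (a := a) (b := b) (c := c)
    (s := Finset.range n) fun k hk => Or.inl ?_), hMg.mono fun z hz => ?_⟩
  · rw [neg_add_eq_sub, sub_ne_zero]
    exact_mod_cast (Finset.mem_range.1 hk).ne
  · rw [hz, Finset.sum_range_succ]
    ring

end LocalForm

/-! ### Local behaviour of the continued zeta function. -/

/-- The continuation of `hZeta` attached to a continuation `M` of the Mellin transform of
`sqLogTanh`. -/
noncomputable def zetaOfMellin (M : ℂ → ℂ) (s : ℂ) : ℂ :=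
  (4 : ℂ) ^ (s - 2) * (Complex.Gamma (s - 1))⁻¹ * M (s - 1)

section ZetaOfMellin

variable {M : ℂ → ℂ} {a b c : ℕ → ℂ}

lemma analyticAt_four_cpow (s : ℂ) : AnalyticAt ℂ (fun s : ℂ => (4 : ℂ) ^ (s - 2)) s := by
  refine Differentiable.analyticAt (fun z => ?_) s
  exact (differentiableAt_id.sub_const 2).const_cpow (Or.inl (by norm_num))

lemma analyticAt_zetaOfMellin {s : ℂ} (hM : AnalyticAt ℂ M (s - 1)) :
    AnalyticAt ℂ (zetaOfMellin M) s := by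
  have hG : AnalyticAt ℂ (fun s : ℂ => (Complex.Gamma (s - 1))⁻¹) s :=
    (Complex.differentiable_one_div_Gamma.comp (differentiable_id.sub_const 1)).analyticAt s
  exact ((analyticAt_four_cpow s).mul hG).mul
    (hM.comp_of_eq (analyticAt_id.sub analyticAt_const) rfl)

/-- `Complex.Gamma` is 0 at its poles, so its inverse there is 0, which is also the true value of
the entire function 1/Γ. -/
lemma zetaOfMellin_neg_two_mul (M : ℂ → ℂ) (n : ℕ) : zetaOfMellin M (-2 * n) = 0 := by
  have : (-2 * (n : ℂ) - 1) = -((2 * n + 1 : ℕ) : ℂ) := by push_cast; ring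
  rw [zetaOfMellin, this, Complex.Gamma_neg_nat_eq_zero]
  simp

lemma tendsto_sub_one {s w : ℂ} (h : s - 1 = w) : Tendsto (fun s : ℂ => s - 1) (𝓝 s) (𝓝 w) := by
  rw [← h]
  exact (continuous_id.sub continuous_const).tendsto s

lemma zetaOfMellin_double_pole (hM : HasPrincipalParts M a b c) (ha : a 0 = 0) (hb : b 0 = 0)
    (hc : c 0 = 1) : ∃ ψ : ℂ → ℂ, AnalyticAt ℂ ψ 1 ∧ ψ 1 = 1 / 2 ∧
      deriv ψ 1 = ((Real.log 2 + Real.eulerMascheroniConstant / 2 : ℝ) : ℂ) ∧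
      ∀ᶠ z in 𝓝[≠] 1, zetaOfMellin M z = ψ z / (z - 1) ^ 2 := by
  obtain ⟨g, hg, hMg⟩ := hM.at_neg_nat 0
  rw [Nat.cast_zero, neg_zero] at hg hMg
  have hg1 : AnalyticAt ℂ (fun s => g (s - 1)) 1 :=
    hg.comp_of_eq (analyticAt_id.sub analyticAt_const) (by simp)
  have hφ : HasDerivAt (fun s : ℂ => (4 : ℂ) ^ (s - 2) * (Complex.Gamma s)⁻¹)
      ((Complex.log 4 + Real.eulerMascheroniConstant) / 4) 1 := by
    have h4 : HasDerivAt (fun s : ℂ => (4 : ℂ) ^ (s - 2)) ((4 : ℂ) ^ ((1 : ℂ) - 2) * Complex.log 4) 1 := by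
      simpa using ((hasDerivAt_id (1 : ℂ)).sub_const 2).const_cpow (c := 4) (Or.inl (by norm_num))
    have hG := Complex.hasDerivAt_Gamma_one.fun_inv (by simp)
    convert! h4.mul hG using 1
    rw [show (1 : ℂ) - 2 = -1 by norm_num, Complex.cpow_neg_one]
    simp
    ring
  have h3 : HasDerivAt (fun s : ℂ => 2 + (s - 1) ^ 3 * g (s - 1)) 0 1 := by
    have h := (((hasDerivAt_id (1 : ℂ)).sub_const 1).fun_pow 3).mul
      hg1.differentiableAt.hasDerivAt
    simpa using h.const_add 2
  -- From 1/Γ(w) = w/Γ(w+1) and M(w) = 2/w³ + g(w) with w = s - 1.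
  refine ⟨fun s => (4 : ℂ) ^ (s - 2) * (Complex.Gamma s)⁻¹ * (2 + (s - 1) ^ 3 * g (s - 1)),
    ?_, ?_, ?_, ?_⟩
  · exact ((analyticAt_four_cpow 1).mul (Complex.differentiable_one_div_Gamma.analyticAt 1)).mul
      (analyticAt_const.add (((analyticAt_id.sub analyticAt_const).pow 3).mul hg1))
  · beta_reduce
    rw [show (1 : ℂ) - 2 = -1 by norm_num, Complex.cpow_neg_one]
    simp
    norm_num
  · rw [(hφ.fun_mul h3).deriv]
    have : Complex.log 4 = 2 * (Real.log 2 : ℂ) := by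
      rw [show (4 : ℂ) = ((4 : ℝ) : ℂ) by norm_num, ← Complex.ofReal_log (by norm_num),
        show (4 : ℝ) = 2 ^ 2 by norm_num, Real.log_pow]
      push_cast
      ring
    rw [this]
    push_cast
    simp
    ring
  · filter_upwards [nhdsWithin_le_nhds ((tendsto_sub_one (sub_self 1)).eventually hMg),
      self_mem_nhdsWithin] with z hz hne
    have hne' : z - 1 ≠ 0 := sub_ne_zero.2 hne
    rw [zetaOfMellin, hz, Complex.one_div_Gamma_eq_self_mul_one_div_Gamma_add_one (z - 1),
      principalPart, ha, hb, hc, sub_add_cancel, Nat.cast_zero, add_zero]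
    field_simp
    ring

lemma zetaOfMellin_simple_pole (hM : HasPrincipalParts M a b c) {n : ℕ} (hc : c (2 * n) = 0) :
    ∃ ψ : ℂ → ℂ, AnalyticAt ℂ ψ (1 - 2 * n) ∧
      ψ (1 - 2 * n) = -b (2 * n) * (2 * n).factorial / 4 ^ (2 * n + 1) ∧
      ∀ᶠ z in 𝓝[≠] (1 - 2 * n), zetaOfMellin M z = ψ z / (z - (1 - 2 * n)) ^ 1 := by
  obtain ⟨g, hg, hMg⟩ := hM.at_neg_nat (2 * n)
  obtain ⟨H, hH, hHG, hHn⟩ := exists_one_div_Gamma_eq_mul (2 * n)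
  have hpt : (1 - 2 * n : ℂ) - 1 = -((2 * n : ℕ) : ℂ) := by push_cast; ring
  have hg1 : AnalyticAt ℂ (fun s => g (s - 1)) (1 - 2 * n) :=
    hg.comp_of_eq (analyticAt_id.sub analyticAt_const) hpt
  have hH1 : AnalyticAt ℂ (fun s => H (s - 1)) (1 - 2 * n) :=
    (hH.comp (differentiable_id.sub_const 1)).analyticAt _
  have hu : AnalyticAt ℂ (fun s : ℂ => s - (1 - 2 * n)) (1 - 2 * n) :=
    analyticAt_id.sub analyticAt_const
  -- With u = w + 2n, this is 1/Γ(w) = u H(w) times M(w) = a/u - b/u² + g(w), multiplied by u.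
  refine ⟨fun s => (4 : ℂ) ^ (s - 2) * H (s - 1) * (-b (2 * n) + a (2 * n) * (s - (1 - 2 * n)) +
    (s - (1 - 2 * n)) ^ 2 * g (s - 1)), ?_, ?_, ?_⟩
  · exact ((analyticAt_four_cpow _).mul hH1).mul
      ((analyticAt_const.add (analyticAt_const.mul hu)).add ((hu.pow 2).mul hg1))
  · have h4 : (4 : ℂ) ^ ((1 - 2 * n : ℂ) - 2) = (4 ^ (2 * n + 1))⁻¹ := by
      rw [show (1 - 2 * n : ℂ) - 2 = -((2 * n + 1 : ℕ) : ℂ) by push_cast; ring, Complex.cpow_neg,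
        Complex.cpow_natCast]
    simp only [hpt, hHn, h4, sub_self]
    rw [(even_two_mul n).neg_one_pow]
    ring
  · filter_upwards [nhdsWithin_le_nhds ((tendsto_sub_one hpt).eventually hMg),
      self_mem_nhdsWithin] with z hz hne
    have hne' : z - (1 - 2 * n) ≠ 0 := sub_ne_zero.2 hne
    have hw : z - 1 + (2 * n : ℕ) = z - (1 - 2 * n) := by push_cast; ring
    rw [zetaOfMellin, hz, hHG, principalPart, hw, hc]
    field_simp
    ring

end ZetaOfMellin

/-! ### The main theorem. -/

theorem mainTheorem6 :
    -- the series and the Mellin integral converge absolutely for `Re s > 1`,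
    -- and the Mellin representation holds there
    (∀ s : ℂ, 1 < s.re →
      LSeriesSummable hZetaCoeff s ∧
      MeasureTheory.IntegrableOn
        (fun x : ℝ => ((Real.log (Real.tanh x) ^ 2 : ℝ) : ℂ) * (x : ℂ) ^ (s - 2)) (Set.Ioi 0) ∧
      hZeta s = (4 : ℂ) ^ (s - 2) / Complex.Gamma (s - 1) *
        ∫ x in Set.Ioi (0 : ℝ),
          ((Real.log (Real.tanh x) ^ 2 : ℝ) : ℂ) * (x : ℂ) ^ (s - 2)) ∧
    -- the continuation `Z`
    ∃ Z : ℂ → ℂ,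
      (∀ s : ℂ, 1 < s.re → Z s = hZeta s) ∧
      (∀ s : ℂ, MeromorphicAt Z s) ∧
      (∀ s : ℂ, (∀ n : ℕ, s ≠ 1 - 2 * (n : ℂ)) → AnalyticAt ℂ Z s) ∧
      -- the double pole at `1`
      meromorphicOrderAt Z 1 = ((-2 : ℤ) : WithTop ℤ) ∧
      HasResidueAt Z 1 ((Real.log 2 + Real.eulerMascheroniConstant / 2 : ℝ) : ℂ) ∧
      -- the simple poles at `1 - 2n`, `n ≥ 1`
      (∀ n : ℕ, 1 ≤ n →
        meromorphicOrderAt Z (1 - 2 * (n : ℂ)) = ((-1 : ℤ) : WithTop ℤ) ∧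
        HasResidueAt Z (1 - 2 * (n : ℂ))
          (-(((Polynomial.bernoulli (2 * n)).eval (1 / 2 : ℚ) : ℚ) : ℂ) / (4 * (n : ℂ)))) ∧
      -- the zeros
      (∀ n : ℕ, Z (-2 * (n : ℂ)) = 0) := by
  have hf := hasLogExpansion_sqLogTanh
  have hint (s : ℂ) : (fun x : ℝ => (x : ℂ) ^ (s - 1 - 1) • sqLogTanh x) =
      fun x : ℝ => ((Real.log (Real.tanh x) ^ 2 : ℝ) : ℂ) * (x : ℂ) ^ (s - 2) := by
    ext x
    rw [smul_eq_mul, mul_comm, sqLogTanh, sub_sub, one_add_one_eq_two]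
  refine ⟨fun s hs => ⟨LSeriesSummable_hZetaCoeff hs, ?_, ?_⟩, ?_⟩
  · rw [← hint]
    exact hf.mellinConvergent (by simpa using hs)
  · rw [hZeta_eq_mellin hs, mellin, hint, div_eq_mul_inv]
  obtain ⟨M, hMellin, hM⟩ := hf.exists_continuation
  change HasPrincipalParts M _ _ _ at hM
  obtain ⟨ψ, hψ, hψ1, hψ', hZψ⟩ := zetaOfMellin_double_pole hM
    (by simp [coeff_zero_taylorSeries, logTanhDiv_zero])
    (by simp [coeff_zero_taylorSeries, logTanhDiv_zero]) (if_pos rfl)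
  have hana : ∀ s : ℂ, (∀ n : ℕ, s ≠ 1 - 2 * (n : ℂ)) → AnalyticAt ℂ (zetaOfMellin M) s := by
    refine fun s hs => analyticAt_zetaOfMellin (hM.analyticAt fun k => ?_)
    -- Even k = 2m could only be singular at the excluded point s = 1 - 2m; for odd k all
    -- coefficients vanish, as L and L² are even.
    rcases Nat.even_or_odd k with hk | hk
    · obtain ⟨m, rfl⟩ := even_iff_exists_two_mul.1 hk
      refine Or.inl fun h => hs m ?_
      push_cast at h
      linear_combination h
    · have hk0 : k ≠ 0 := by rintro rfl; simp at hk
      have he (x : ℝ) : (logTanhDiv * logTanhDiv) (-x) = (logTanhDiv * logTanhDiv) x := by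
        simp [logTanhDiv_neg]
      exact Or.inr ⟨by simp [coeff_taylorSeries_eq_zero_of_even he hk],
        by simp [coeff_taylorSeries_eq_zero_of_even logTanhDiv_neg hk], if_neg hk0⟩
  have hpole : ∀ n : ℕ, 1 ≤ n → ∃ ψ : ℂ → ℂ, AnalyticAt ℂ ψ (1 - 2 * n) ∧
      ψ (1 - 2 * n) =
        -(((Polynomial.bernoulli (2 * n)).eval (1 / 2 : ℚ) : ℚ) : ℂ) / (4 * (n : ℂ)) ∧
      ∀ᶠ z in 𝓝[≠] (1 - 2 * n : ℂ), zetaOfMellin M z = ψ z / (z - (1 - 2 * n)) ^ 1 := by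
    intro n hn
    obtain ⟨ψ, hψ, hψn, hZ⟩ := zetaOfMellin_simple_pole hM (n := n) (if_neg (by omega))
    refine ⟨ψ, hψ, hψn.trans ?_, hZ⟩
    have h := congrArg (fun x : ℝ => (x : ℂ))
      (coeff_taylorSeries_logTanhDiv (n := 2 * n) (by omega))
    have hn0 : (n : ℂ) ≠ 0 := by exact_mod_cast (by omega : n ≠ 0)
    have hfac : ((2 * n).factorial : ℂ) ≠ 0 := by exact_mod_cast Nat.factorial_ne_zero _
    push_cast at h ⊢
    rw [eq_div_iff hfac] at h
    rw [div_eq_div_iff (pow_ne_zero _ (by norm_num)) (by simpa using hn0), pow_succ]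
    linear_combination (-4 : ℂ) * h
  refine ⟨zetaOfMellin M, fun s hs => ?_, fun s => ?_, hana, ?_, hψ' ▸
    hasResidueAt_of_double_pole hψ hZψ, fun n hn => ?_, zetaOfMellin_neg_two_mul M⟩
  · rw [hZeta_eq_mellin hs, zetaOfMellin, hMellin _ (by simpa using hs)]
  · by_cases hs : ∀ n : ℕ, s ≠ 1 - 2 * (n : ℂ)
    · exact (hana s hs).meromorphicAt
    · push Not at hs
      obtain ⟨n, rfl⟩ := hs
      rcases Nat.eq_zero_or_pos n with rfl | hn
      · rw [Nat.cast_zero, mul_zero, sub_zero]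
        exact meromorphicAt_of_eventuallyEq_div_pow hψ hZψ
      · obtain ⟨φ, hφ, -, hZφ⟩ := hpole n hn
        exact meromorphicAt_of_eventuallyEq_div_pow hφ hZφ
  · exact meromorphicOrderAt_of_eventuallyEq_div_pow hψ (by rw [hψ1]; norm_num) hZψ
  · obtain ⟨φ, hφ, hφn, hZφ⟩ := hpole n hn
    refine ⟨meromorphicOrderAt_of_eventuallyEq_div_pow (m := 1) hφ ?_ hZφ,
      hφn ▸ hasResidueAt_of_simple_pole hφ hZφ⟩
    rw [hφn]
    refine div_ne_zero (neg_ne_zero.2 ?_) ?_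
    · exact_mod_cast bernoulli_eval_half_ne_zero hn
    · exact mul_ne_zero (by norm_num) (by exact_mod_cast (by omega : n ≠ 0))
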